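/- **Setting.** A $d$-dimensional linear RLHF instance with horizon $H$ and reward bound $R_{\max}$ consists of finite state and action spaces $\mathcal S,\mathcal A$, a known feature map $\phi:\mathcal S\times\mathcal A\to\mathbb R^d$ with $\|\phi(s,a)\|_2\le 1$, an initial distribution $\rho$ on $\mathcal S$, a reference policy $\pi_{\rm ref}:\mathcal S\to\Delta(\mathcal A)$ of full support, and unknown parameters $\mu:\mathcal S\to\mathbb R^d$, $\nu\in\mathbb R^d$ with $\|\sum_{s'}\mu(s')\|_2\le\sqrt d$, $\|\nu\|_2\le 1$, such that $P(s'|s,a)=\phi(s,a)^\top\mu(s')$ is a transition function and, with $r(s,a)=\phi(s,a)^\top\nu$, every trajectory $\tau=((s_1,a_1),\dots,(s_H,a_H))$ has total reward $r(\tau)=\sum_{h=1}^H r(s_h,a_h)\in[0,R_{\max}]$. A policy is a map $\pi:\mathcal S\to\Delta(\mathcal A)$; it generates $s_1\sim\rho$, $a_h\sim\pi(\cdot|s_h)$, $s_{h+1}\sim P(\cdot|s_h,a_h)$. For $\beta>0$ let $$J_\beta(\pi)=\mathbb E_\pi[r(\tau)]-\beta\,\mathbb E_\pi\Big[\sum_{h=1}^H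 D_{KL}\big(\pi(\cdot|s_h)\,\|\,\pi_{\rm ref}(\cdot|s_h)\big)\Big],$$ and let $\pi^\star_\beta$ be a maximizer of $J_\beta$ over all policies. An online algorithm $\mathcal A$ with $T$ rounds may know $T$, $H$, $R_{\max}$, $\mathcal S,\mathcal A,\phi,\rho,\pi_{\rm ref},\beta$, but not $\mu,\nu$, and may be randomized. In each round $t=1,\dots,T$ it chooses, depending on all past observations, two policies $\pi^{(t)},\tilde\pi^{(t)}$; then $s_1\sim\rho$ is drawn, trajectories $\tau\sim\pi^{(t)}$ and $\tilde\tau\sim\tilde\pi^{(t)}$ are drawn independently from $s_1$, and the algorithm observes $\tau,\tilde\tau$ and a binary label that says $\tau\succ\tilde\tau$ with probability $e^{r(\tau)}/(e^{r(\tau)}+e^{r(\tilde\tau)})$. After $T$ rounds it returns a policy $\hat\pi_T^{\mathcal A}$. **Theorem (minimax lower bound for online RLHF).** There is a universal constant $c>0$ such that the following holds for all integers $d\ge 2$, $H\ge 1$, $T\ge 1$ and all real $R_{\max}$ with $\sqrt{d^2/T}\le\min(H,R_{\max})$. For every online algorithm $\mathcal A$ with $T$ rounds there are a $d$-dimensional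 linear RLHF instance with horizon $H$ and reward bound $R_{\max}$ and a $\beta>0$ such that a maximizer $\pi^\star_\beta$ exists and $$\mathbb E\big[J_\beta(\pi^\star_\beta)-J_\beta(\hat\pi_T^{\mathcal A})\big]\ \ge\ c\,\sqrt{\frac{d^2}{T}} \qquad\text{and}\qquad \mathbb P\Big(J_\beta(\pi^\star_\beta)-J_\beta(\hat\pi_T^{\mathcal A})\ \ge\ c\,\sqrt{\frac{d^2}{T}}\Big)\ \ge\ c,$$ where expectation and probability are over the interaction and the randomness of the algorithm. -/

import Mathlib

open scoped BigOperators

/-- A (stationary, randomized) policy `π : S → Δ(A)`; `(π s).1 a` is `π(a | s)`. -/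
abbrev Policy (S A : Type) [Fintype A] : Type := S → stdSimplex ℝ A

/-- A trajectory `τ = ((s_1, a_1), …, (s_H, a_H))`; time steps are indexed from `0`. -/
abbrev Traj (S A : Type) (H : ℕ) : Type := Fin H → S × A

/-- What is observed in one round of preference feedback: the two trajectories and the
preference label (`true` means that the first trajectory is preferred). -/
abbrev Round (S A : Type) (H : ℕ) : Type := Traj S A H × Traj S A H × Bool

/-- The part of an online RLHF instance over a `d`-dimensional linear MDP that may be known to an
algorithm: state and action space, feature map, initial distribution and reference policy. -/
structure KnownData (d : ℕ) where
  /-- state space -/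
  S : Type
  /-- action space -/
  A : Type
  [fintypeS : Fintype S]
  [fintypeA : Fintype A]
  /-- feature map -/
  φ : S → A → EuclideanSpace ℝ (Fin d)
  norm_φ_le : ∀ s a, ‖φ s a‖ ≤ 1
  /-- initial state distribution -/
  ρ : stdSimplex ℝ S
  /-- reference policy -/
  πref : Policy S A
  /-- full support, so that every relative entropy with respect to `πref` is finite -/
  πref_pos : ∀ s a, 0 < (πref s).1 a

attribute [instance] KnownData.fintypeS KnownData.fintypeA

/-- The unknown parameters `μ`, `ν` of the linear MDP, subject to: `P(s' | s, a) = ⟪φ(s, a), μ(s')⟫`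
is a transition function, the norm bounds of a linear MDP hold, and the total reward of every
trajectory of length `H` lies in `[0, Rmax]`, where `r(s, a) = ⟪φ(s, a), ν⟫`. -/
structure LinearModel {d : ℕ} (K : KnownData d) (H : ℕ) (Rmax : ℝ) where
  μ : K.S → EuclideanSpace ℝ (Fin d)
  ν : EuclideanSpace ℝ (Fin d)
  norm_sum_μ_le : ‖∑ s', μ s'‖ ≤ Real.sqrt d
  norm_ν_le : ‖ν‖ ≤ 1
  trans_nonneg : ∀ s a s', 0 ≤ inner ℝ (K.φ s a) (μ s')
  trans_sum : ∀ s a, ∑ s', inner ℝ (K.φ s a) (μ s') = 1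
  reward_mem : ∀ τ : Traj K.S K.A H,
    ∑ h, inner ℝ (K.φ (τ h).1 (τ h).2) ν ∈ Set.Icc 0 Rmax

/-- Relative entropy `D_KL(p ‖ q) = ∑ a, p(a) log (p(a) / q(a))` of distributions on a finite set
(used for `q` of full support; `0 log 0 = 0`). -/
noncomputable def klFinite {A : Type} [Fintype A] (p q : stdSimplex ℝ A) : ℝ :=
  ∑ a, p.1 a * Real.log (p.1 a / q.1 a)

namespace LinearModel

variable {d H : ℕ} {Rmax : ℝ} {K : KnownData d}

/-- Transition probability `P(s' | s, a)`. -/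
noncomputable def trans (M : LinearModel K H Rmax) (s : K.S) (a : K.A) (s' : K.S) : ℝ :=
  inner ℝ (K.φ s a) (M.μ s')

/-- Reward `r(s, a)`. -/
noncomputable def reward (M : LinearModel K H Rmax) (s : K.S) (a : K.A) : ℝ :=
  inner ℝ (K.φ s a) M.ν

/-- Total reward `r(τ)` of a trajectory. -/
noncomputable def trajReward (M : LinearModel K H Rmax) (τ : Traj K.S K.A H) : ℝ :=
  ∑ h, M.reward (τ h).1 (τ h).2

/-- Probability of the trajectory `τ` under the policy `π`, given its initial state:
`∏_h π(a_h | s_h) · ∏_{h < H} P(s_{h+1} | s_h, a_h)`. -/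
noncomputable def trajProb (M : LinearModel K H Rmax) (π : Policy K.S K.A)
    (τ : Traj K.S K.A H) : ℝ :=
  (∏ h : Fin H, (π (τ h).1).1 (τ h).2) *
    ∏ h : Fin H, if hh : h.1 + 1 < H then
      M.trans (τ h).1 (τ h).2 (τ ⟨h.1 + 1, hh⟩).1 else 1

/-- Bradley–Terry probability that `τ` is preferred over `τ'`. -/
noncomputable def prefProb (M : LinearModel K H Rmax) (τ τ' : Traj K.S K.A H) : ℝ :=
  Real.exp (M.trajReward τ) / (Real.exp (M.trajReward τ) + Real.exp (M.trajReward τ'))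

variable [NeZero H]

/-- Expectation `𝔼_π[f(τ)]` when `s_1 ∼ ρ` and the trajectory `τ` follows the policy `π`. -/
noncomputable def trajExp (M : LinearModel K H Rmax) (π : Policy K.S K.A)
    (f : Traj K.S K.A H → ℝ) : ℝ :=
  ∑ τ : Traj K.S K.A H, K.ρ.1 (τ 0).1 * M.trajProb π τ * f τ

/-- The objective
`J_β(π) = 𝔼_π[r(τ)] - β 𝔼_π[∑_h D_KL(π(· | s_h) ‖ πref(· | s_h))]`. -/
noncomputable def J (M : LinearModel K H Rmax) (β : ℝ) (π : Policy K.S K.A) : ℝ :=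
  M.trajExp π M.trajReward -
    β * M.trajExp π (fun τ => ∑ h, klFinite (π (τ h).1) (K.πref (τ h).1))

open Classical in
/-- Probability of the outcome `(τ, τ', o)` of a round in which the policies `π`, `π'` are played:
`s_1 ∼ ρ`, then `τ ∼ π` and `τ' ∼ π'` independently from the common initial state `s_1`, then `o`
is drawn from the preference model. -/
noncomputable def roundProb (M : LinearModel K H Rmax) (π π' : Policy K.S K.A)
    (x : Round K.S K.A H) : ℝ :=
  (if (x.1 0).1 = (x.2.1 0).1 then K.ρ.1 (x.1 0).1 else 0) *
    M.trajProb π x.1 * M.trajProb π' x.2.1 *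
    (if x.2.2 then M.prefProb x.1 x.2.1 else 1 - M.prefProb x.1 x.2.1)

end LinearModel

/-- A learner that interacts for `T` rounds. It draws its internal randomness `ω` once; in round
`t` it plays a pair of policies that depends on `ω` and on all earlier outcomes; after `T` rounds
it returns a policy. -/
structure Learner (S A : Type) [Fintype S] [Fintype A] (H T : ℕ) where
  Seed : Type
  [measurableSeed : MeasurableSpace Seed]
  seedLaw : MeasureTheory.Measure Seed
  [isProb : MeasureTheory.IsProbabilityMeasure seedLaw]
  play : (t : Fin T) → (Fin t.1 → Round S A H) → Seed → Policy S A × Policy S A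
  measurable_play : ∀ t past, Measurable (play t past)
  output : (Fin T → Round S A H) → Seed → Policy S A
  measurable_output : ∀ z, Measurable (output z)

attribute [instance] Learner.measurableSeed Learner.isProb

/-- An algorithm for online RLHF with horizon `H` and `T` rounds: given the known data and the
regularization parameter `β`, it acts as a learner. It has no access to `μ` and `ν`. -/
abbrev OnlineAlgorithm (d H T : ℕ) : Type 1 :=
  (K : KnownData d) → (β : ℝ) → Learner K.S K.A H T

namespace LinearModel

variable {d H T : ℕ} {Rmax : ℝ} {K : KnownData d} [NeZero H]

/-- Probability of the sequence `z` of outcomes of all `T` rounds, given the internal randomness. -/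
noncomputable def transcriptProb (M : LinearModel K H Rmax) (L : Learner K.S K.A H T)
    (ω : L.Seed) (z : Fin T → Round K.S K.A H) : ℝ :=
  ∏ t : Fin T,
    M.roundProb (L.play t (fun i => z ⟨i.1, i.2.trans t.2⟩) ω).1
      (L.play t (fun i => z ⟨i.1, i.2.trans t.2⟩) ω).2 (z t)

/-- Expectation `𝔼[f(π̂)]` over the policy `π̂` returned by the learner after `T` rounds. -/
noncomputable def outputExp (M : LinearModel K H Rmax) (L : Learner K.S K.A H T)
    (f : Policy K.S K.A → ℝ) : ℝ :=
  ∫ ω, ∑ z : Fin T → Round K.S K.A H, M.transcriptProb L ω z * f (L.output z ω) ∂L.seedLaw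

/-- Probability that the policy returned by the learner after `T` rounds lies in `E`. -/
noncomputable def outputProb (M : LinearModel K H Rmax) (L : Learner K.S K.A H T)
    (E : Set (Policy K.S K.A)) : ℝ :=
  M.outputExp L (E.indicator 1)

end LinearModel

/-! A single state suffices. The actions are the vertices of the cube of dimension n = d - 1, and a
hidden vertex σ pays 2κ per step for each coordinate of the action that agrees with it. The law of a
trajectory given the policy is then free of σ, so only the preference labels carry information, one
bit per round.

Flipping a bit of σ moves a log-odds by at most 4Hκ. The Bhattacharyya coefficient of a round is
therefore at least exp(-(Hκ)²/2) (`exp_le_affinity`), and it multiplies over adaptive rounds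
(`pow_le_sum_prod_past`). For κ = 1/(2H√T) neighbouring vertices stay indistinguishable after T
rounds, and `assouad` makes the output miss a constant fraction of the n bits on average. Each
missed bit costs 2Hκ = 1/√T, which gives a gap of order n/√T. A small β keeps the entropy term below
this (`le_J_sub_J`). Since the missed fraction is bounded by 1, its mean also yields the bound in
probability. -/

/-! ### Sums over adaptive transcripts -/

theorem sum_prod_past_succ {X : Type*} [Fintype X] {T : ℕ}
    (k : (t : Fin (T + 1)) → (Fin t.1 → X) → X → ℝ) :
    ∑ z : Fin (T + 1) → X, ∏ t : Fin (T + 1), k t (fun i => z ⟨i.1, i.2.trans t.2⟩) (z t) =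
      ∑ z : Fin T → X, (∏ t : Fin T, k t.castSucc (fun i => z ⟨i.1, i.2.trans t.2⟩) (z t)) *
        ∑ x, k (Fin.last T) z x := by
  rw [← (Fin.snocEquiv (fun _ : Fin (T + 1) => X)).sum_comp, Fintype.sum_prod_type_right]
  simp only [Fin.prod_univ_castSucc, Fin.snocEquiv_apply, Fin.snoc_last, Fin.snoc_castSucc]
  refine Finset.sum_congr rfl fun z _ => ?_
  have e1 : ∀ (t : Fin T) (x : X), (fun i : Fin t.castSucc.1 =>
      (Fin.snoc z x : Fin (T + 1) → X) ⟨i.1, i.2.trans t.castSucc.2⟩) =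
      fun i : Fin t.1 => z ⟨i.1, i.2.trans t.2⟩ := by
    intro t x; funext i
    exact Fin.snoc_castSucc (α := fun _ => X) x z ⟨i.1, i.2.trans t.2⟩
  have e2 : ∀ x : X, (fun i : Fin (Fin.last T).1 =>
      (Fin.snoc z x : Fin (T + 1) → X) ⟨i.1, i.2.trans (Fin.last T).2⟩) = z := by
    intro x; funext i
    exact Fin.snoc_castSucc (α := fun _ => X) x z i
  simp only [e1, e2, Finset.mul_sum]
  rfl

theorem sum_prod_past_eq_one {X : Type*} [Fintype X] :
    ∀ (T : ℕ) (k : (t : Fin T) → (Fin t.1 → X) → X → ℝ), (∀ t past, ∑ x, k t past x = 1) →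
      ∑ z : Fin T → X, ∏ t : Fin T, k t (fun i => z ⟨i.1, i.2.trans t.2⟩) (z t) = 1
  | 0, _, _ => by simp
  | T + 1, k, hs => by
    simp only [sum_prod_past_succ, hs, mul_one]
    exact sum_prod_past_eq_one T (fun t => k t.castSucc) fun t => hs t.castSucc

/-- Summing out the last round leaves a factor of at least q, whatever the past was. The kernels
need not be normalized: they will be geometric means of two round laws. -/
theorem pow_le_sum_prod_past {X : Type*} [Fintype X] {q : ℝ} (hq : 0 ≤ q) :
    ∀ (T : ℕ) (k : (t : Fin T) → (Fin t.1 → X) → X → ℝ), (∀ t past x, 0 ≤ k t past x) →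
      (∀ t past, q ≤ ∑ x, k t past x) →
      q ^ T ≤ ∑ z : Fin T → X, ∏ t : Fin T, k t (fun i => z ⟨i.1, i.2.trans t.2⟩) (z t)
  | 0, _, _, _ => by simp
  | T + 1, k, hk, hs => by
    rw [sum_prod_past_succ, pow_succ]
    refine (mul_le_mul_of_nonneg_right (pow_le_sum_prod_past hq T (fun t => k t.castSucc)
      (fun t => hk t.castSucc) fun t => hs t.castSucc) hq).trans ?_
    rw [Finset.sum_mul]
    exact Finset.sum_le_sum fun z _ =>
      mul_le_mul_of_nonneg_left (hs _ _) (Finset.prod_nonneg fun t _ => hk _ _ _)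

/-! ### Testing affinities and product laws -/

/-- Le Cam's inequality between the testing affinity and the Bhattacharyya coefficient. -/
theorem sq_sum_sqrt_mul_le {Z : Type*} [Fintype Z] (P Q : Z → ℝ) (hP : ∀ z, 0 ≤ P z)
    (hQ : ∀ z, 0 ≤ Q z) (hP1 : ∑ z, P z = 1) (hQ1 : ∑ z, Q z = 1) :
    (∑ z, √(P z * Q z)) ^ 2 ≤ 2 * ∑ z, min (P z) (Q z) := by
  -- Cauchy–Schwarz on this factorization, with the total mass of the maximum at most 2.
  have h1 : ∀ z, √(P z * Q z) = √(min (P z) (Q z)) * √(max (P z) (Q z)) := fun z => by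
    rw [← Real.sqrt_mul (le_min (hP z) (hQ z)), min_mul_max]
  have h2 := Finset.sum_mul_sq_le_sq_mul_sq Finset.univ
    (fun z => √(min (P z) (Q z))) (fun z => √(max (P z) (Q z)))
  simp only [Real.sq_sqrt (le_min (hP _) (hQ _)),
    Real.sq_sqrt ((hP _).trans (le_max_left (P _) (Q _)))] at h2
  simp only [h1]
  have h3 : ∑ z, max (P z) (Q z) ≤ 2 := by
    calc _ ≤ ∑ z, (P z + Q z) := Finset.sum_le_sum fun z _ =>
          max_le (by linarith [hQ z]) (by linarith [hP z])
      _ = 2 := by rw [Finset.sum_add_distrib, hP1, hQ1]; norm_num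
  have h4 : 0 ≤ ∑ z, min (P z) (Q z) := Finset.sum_nonneg fun z _ => le_min (hP z) (hQ z)
  nlinarith

theorem sum_min_le_test {Z : Type*} [Fintype Z] (P Q W : Z → ℝ)
    (hW0 : ∀ z, 0 ≤ W z) (hW1 : ∀ z, W z ≤ 1) :
    ∑ z, min (P z) (Q z) ≤ ∑ z, P z * W z + ∑ z, Q z * (1 - W z) := by
  rw [← Finset.sum_add_distrib]
  refine Finset.sum_le_sum fun z _ => ?_
  nlinarith [mul_le_mul_of_nonneg_right (min_le_left (P z) (Q z)) (hW0 z),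
    mul_le_mul_of_nonneg_right (min_le_right (P z) (Q z)) (sub_nonneg.2 (hW1 z))]

/-- Bhattacharyya coefficient of two Bradley–Terry labels. -/
theorem exp_le_affinity (a b a' b' : ℝ) :
    Real.exp (-((a - b) - (a' - b')) ^ 2 / 32) ≤
      √(Real.exp a / (Real.exp a + Real.exp b) * (Real.exp a' / (Real.exp a' + Real.exp b'))) +
      √((1 - Real.exp a / (Real.exp a + Real.exp b)) *
        (1 - Real.exp a' / (Real.exp a' + Real.exp b'))) := by
  -- In these variables the affinity equals cosh(u+v) / √(cosh 2u · cosh 2v). It is bounded below by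
  -- 1 / cosh(u-v), and cosh x ≤ exp(x²/2) finishes.
  set u := (a - b) / 4 with hu
  set v := (a' - b') / 4 with hv
  have key : ∀ a b : ℝ, Real.exp a / (Real.exp a + Real.exp b) =
      Real.exp (2 * ((a - b) / 4)) / (2 * Real.cosh (2 * ((a - b) / 4))) ∧
      1 - Real.exp a / (Real.exp a + Real.exp b) =
      Real.exp (-(2 * ((a - b) / 4))) / (2 * Real.cosh (2 * ((a - b) / 4))) := by
    intro a b
    rw [Real.cosh_eq]
    have e1 : Real.exp a = Real.exp ((a + b) / 2) * Real.exp (2 * ((a - b) / 4)) := by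
      rw [← Real.exp_add]; ring_nf
    have e2 : Real.exp b = Real.exp ((a + b) / 2) * Real.exp (-(2 * ((a - b) / 4))) := by
      rw [← Real.exp_add]; ring_nf
    rw [e1, e2]
    have := Real.exp_pos ((a + b) / 2)
    have := Real.exp_pos (2 * ((a - b) / 4))
    have := Real.exp_pos (-(2 * ((a - b) / 4)))
    constructor <;> field_simp
    ring
  rw [(key a b).2, (key a' b').2, (key a b).1, (key a' b').1, ← hu, ← hv]
  have hcu := Real.cosh_pos (2 * u)
  have hcv := Real.cosh_pos (2 * v)
  have hexp : ∀ x y : ℝ, √(Real.exp (2 * x) / (2 * Real.cosh (2 * u)) *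
      (Real.exp (2 * y) / (2 * Real.cosh (2 * v)))) =
      Real.exp (x + y) / (2 * √(Real.cosh (2 * u) * Real.cosh (2 * v))) := by
    intro x y
    rw [Real.sqrt_eq_iff_mul_self_eq (by positivity) (by positivity), div_mul_div_comm,
      div_mul_div_comm, ← Real.exp_add, ← Real.exp_add]
    congr 1
    · ring_nf
    · nlinarith [Real.mul_self_sqrt (mul_pos hcu hcv).le]
  have e1 := hexp u v
  have e2 := hexp (-u) (-v)
  simp only [mul_neg] at e2
  rw [e1, e2, ← add_div]
  have e3 : Real.exp (u + v) + Real.exp (-u + -v) = 2 * Real.cosh (u + v) := by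
    rw [Real.cosh_eq, neg_add]; ring
  rw [e3, mul_div_mul_left _ _ two_ne_zero]
  have h1 : Real.exp (-((a - b) - (a' - b')) ^ 2 / 32) ≤ 1 / Real.cosh (u - v) := by
    rw [le_div_iff₀ (Real.cosh_pos _)]
    have := Real.cosh_le_exp_half_sq (u - v)
    calc _ ≤ Real.exp (-((a - b) - (a' - b')) ^ 2 / 32) * Real.exp ((u - v) ^ 2 / 2) := by
          gcongr
      _ = 1 := by
        rw [← Real.exp_add, hu, hv, Real.exp_eq_one_iff]; ring
  refine h1.trans ?_
  rw [div_le_div_iff₀ (Real.cosh_pos _) (by positivity), one_mul]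
  refine Real.sqrt_le_iff.2 ⟨(mul_pos (Real.cosh_pos _) (Real.cosh_pos _)).le, ?_⟩
  have hs : Real.cosh (2 * u) * Real.cosh (2 * v) =
      (Real.cosh (u + v)) ^ 2 + (Real.cosh (u - v)) ^ 2 - 1 := by
    rw [Real.cosh_two_mul, Real.cosh_two_mul, Real.cosh_add, Real.cosh_sub]
    have := Real.cosh_sq u
    have := Real.cosh_sq v
    have e : Real.sinh u ^ 2 = Real.cosh u ^ 2 - 1 := by linarith
    have e' : Real.sinh v ^ 2 = Real.cosh v ^ 2 - 1 := by linarith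
    ring_nf
    rw [e, e']; ring
  rw [hs]
  -- With X = cosh²(u+v) and Y = cosh²(u-v), the claim X + Y - 1 ≤ XY is (X-1)(Y-1) ≥ 0.
  nlinarith [mul_nonneg (sub_nonneg.2 (one_le_pow₀ (Real.one_le_cosh (u + v)) (n := 2)))
    (sub_nonneg.2 (one_le_pow₀ (Real.one_le_cosh (u - v)) (n := 2)))]

/-- Expectation of a function of one coordinate under a product distribution. -/
theorem sum_prod_mul_coord {ι X : Type*} [Fintype ι] [DecidableEq ι] [Fintype X] (p : X → ℝ)
    (hp : ∑ x, p x = 1) (g : X → ℝ) (k : ι) :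
    ∑ z : ι → X, (∏ i, p (z i)) * g (z k) = ∑ x, p x * g x := by
  -- Absorbing `g` into the k-th factor makes the summand a product, so the sum factorizes.
  have h : ∀ z : ι → X, (∏ i, p (z i)) * g (z k) =
      ∏ i, (p (z i) * if i = k then g (z i) else 1) := fun z => by
    rw [Finset.prod_mul_distrib]; simp
  simp only [h]
  rw [← Fintype.piFinset_univ, ← Finset.prod_univ_sum (fun _ => Finset.univ)
    (fun i x => p x * if i = k then g x else 1)]
  rw [Finset.prod_eq_single k]
  · simp
  · intro i _ hi; simp [hi, hp]
  · simp

/-! ### The interaction protocol over a single state -/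

namespace LinearModel

theorem prefProb_mem {d H : ℕ} {Rmax : ℝ} {K : KnownData d}
    (M : LinearModel K H Rmax) (τ τ' : Traj K.S K.A H) :
    M.prefProb τ τ' ∈ Set.Icc 0 1 := by
  have h1 := Real.exp_pos (M.trajReward τ)
  have h2 := Real.exp_pos (M.trajReward τ')
  exact ⟨by rw [prefProb]; positivity, div_le_one_of_le₀ (by linarith) (by linarith)⟩

theorem label_nonneg {d H : ℕ} {Rmax : ℝ} {K : KnownData d} (M : LinearModel K H Rmax) (x : Round K.S K.A H) :
    0 ≤ if x.2.2 then M.prefProb x.1 x.2.1 else 1 - M.prefProb x.1 x.2.1 := by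
  have := M.prefProb_mem x.1 x.2.1
  split_ifs
  exacts [this.1, sub_nonneg.2 this.2]

section SingleState

variable {d H T : ℕ} {Rmax : ℝ} {K : KnownData d} [Unique K.S]

theorem trans_eq_one (M : LinearModel K H Rmax) (s : K.S) (a : K.A) (s' : K.S) :
    M.trans s a s' = 1 := by
  have h := M.trans_sum s a
  rw [Fintype.sum_unique] at h
  rw [trans, Subsingleton.elim s' default, h]

/-- The right-hand side does not involve the model, so trajectories alone reveal nothing about the
parameters. -/
theorem trajProb_eq_prod (M : LinearModel K H Rmax) (π : Policy K.S K.A) (τ : Traj K.S K.A H) :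
    M.trajProb π τ = ∏ h, (π default).1 (τ h).2 := by
  simp only [trajProb, trans_eq_one, dite_eq_ite, ite_self, Finset.prod_const_one, mul_one]
  exact Finset.prod_congr rfl fun h _ => by rw [Subsingleton.elim (τ h).1 default]

theorem trajProb_nonneg (M : LinearModel K H Rmax) (π : Policy K.S K.A) (τ : Traj K.S K.A H) :
    0 ≤ M.trajProb π τ := by
  rw [trajProb_eq_prod]
  exact Finset.prod_nonneg fun h _ => (π default).2.1 _

theorem sum_trajProb_mul (M : LinearModel K H Rmax) (π : Policy K.S K.A) (g : K.A → ℝ)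
    (k : Fin H) : ∑ τ, M.trajProb π τ * g (τ k).2 = ∑ a, (π default).1 a * g a := by
  simp only [trajProb_eq_prod]
  rw [sum_prod_mul_coord (fun x : K.S × K.A => (π default).1 x.2) ?_ (fun x => g x.2) k,
    Fintype.sum_prod_type, Fintype.sum_unique]
  rw [Fintype.sum_prod_type, Fintype.sum_unique]
  exact (π default).2.2

theorem initial_eq_one (s : K.S) : K.ρ.1 s = 1 := by
  have h := K.ρ.2.2
  rw [Fintype.sum_unique] at h
  rw [Subsingleton.elim s default]
  exact h

variable [NeZero H]

theorem sum_trajProb (M : LinearModel K H Rmax) (π : Policy K.S K.A) :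
    ∑ τ, M.trajProb π τ = 1 := by
  have h := M.sum_trajProb_mul π (fun _ => 1) 0
  simpa only [mul_one, (π default).2.2] using h

theorem trajExp_sum_action (M : LinearModel K H Rmax) (π : Policy K.S K.A) (g : K.A → ℝ) :
    M.trajExp π (fun τ => ∑ h, g (τ h).2) = H * ∑ a, (π default).1 a * g a := by
  simp only [trajExp, initial_eq_one, one_mul, Finset.mul_sum (s := (Finset.univ : Finset (Fin H)))]
  rw [Finset.sum_comm]
  simp only [sum_trajProb_mul, Finset.sum_const, Finset.card_univ, Fintype.card_fin, nsmul_eq_mul]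

theorem J_eq (M : LinearModel K H Rmax) (β : ℝ) (π : Policy K.S K.A) :
    M.J β π = H * ∑ a, (π default).1 a * M.reward default a -
      β * (H * klFinite (π default) (K.πref default)) := by
  have h1 : M.trajReward = fun τ => ∑ h, M.reward default (τ h).2 := by
    funext τ
    exact Finset.sum_congr rfl fun h _ => by rw [Subsingleton.elim (τ h).1 default]
  have h2 : (fun τ : Traj K.S K.A H => ∑ h, klFinite (π (τ h).1) (K.πref (τ h).1)) =
      fun τ => ∑ h, (fun _ : K.A => klFinite (π default) (K.πref default)) (τ h).2 := by
    funext τ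
    exact Finset.sum_congr rfl fun h _ => by rw [Subsingleton.elim (τ h).1 default]
  rw [J, h1, h2, trajExp_sum_action,
    trajExp_sum_action M π fun _ => klFinite (π default) (K.πref default), ← Finset.sum_mul]
  rw [show ∑ a, (π default).1 a = 1 from (π default).2.2, one_mul]

theorem roundProb_eq (M : LinearModel K H Rmax) (π π' : Policy K.S K.A) (x : Round K.S K.A H) :
    M.roundProb π π' x = M.trajProb π x.1 * M.trajProb π' x.2.1 *
      (if x.2.2 then M.prefProb x.1 x.2.1 else 1 - M.prefProb x.1 x.2.1) := by
  rw [roundProb, if_pos (Subsingleton.elim _ _), initial_eq_one, one_mul]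

theorem roundProb_nonneg (M : LinearModel K H Rmax) (π π' : Policy K.S K.A)
    (x : Round K.S K.A H) : 0 ≤ M.roundProb π π' x := by
  rw [roundProb_eq]
  exact mul_nonneg (mul_nonneg (M.trajProb_nonneg _ _) (M.trajProb_nonneg _ _)) (M.label_nonneg x)

theorem sum_roundProb (M : LinearModel K H Rmax) (π π' : Policy K.S K.A) :
    ∑ x, M.roundProb π π' x = 1 := by
  simp only [roundProb_eq, Fintype.sum_prod_type, Fintype.sum_bool, if_true, Bool.false_eq_true,
    if_false, ← mul_add, add_sub_cancel, mul_one]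
  simp only [← Finset.mul_sum, sum_trajProb, mul_one]

/-- The trajectory factors agree under both models and leave the square root. What remains is an
average of label affinities. -/
theorem le_sum_sqrt_roundProb {M M' : LinearModel K H Rmax} {q : ℝ}
    (hq : ∀ τ τ', q ≤ √(M.prefProb τ τ' * M'.prefProb τ τ') +
      √((1 - M.prefProb τ τ') * (1 - M'.prefProb τ τ'))) (π π' : Policy K.S K.A) :
    q ≤ ∑ x, √(M.roundProb π π' x * M'.roundProb π π' x) := by
  have h : ∀ x : Round K.S K.A H, √(M.roundProb π π' x * M'.roundProb π π' x) =
      M.trajProb π x.1 * M.trajProb π' x.2.1 *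
      √((if x.2.2 then M.prefProb x.1 x.2.1 else 1 - M.prefProb x.1 x.2.1) *
        (if x.2.2 then M'.prefProb x.1 x.2.1 else 1 - M'.prefProb x.1 x.2.1)) := fun x => by
    have h0 := mul_nonneg (M.trajProb_nonneg π x.1) (M.trajProb_nonneg π' x.2.1)
    rw [roundProb_eq, roundProb_eq, trajProb_eq_prod M', trajProb_eq_prod M',
      ← trajProb_eq_prod M, ← trajProb_eq_prod M, mul_mul_mul_comm,
      Real.sqrt_mul (mul_self_nonneg _), Real.sqrt_mul_self h0]
  simp only [h, Fintype.sum_prod_type, Fintype.sum_bool, if_true, Bool.false_eq_true,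
    if_false, ← mul_add]
  calc q = ∑ τ, ∑ τ', M.trajProb π τ * M.trajProb π' τ' * q := by
        simp only [← Finset.sum_mul, ← Finset.mul_sum, sum_trajProb, mul_one, one_mul]
    _ ≤ _ := Finset.sum_le_sum fun τ _ => Finset.sum_le_sum fun τ' _ =>
        mul_le_mul_of_nonneg_left (hq τ τ')
          (mul_nonneg (M.trajProb_nonneg _ _) (M.trajProb_nonneg _ _))

theorem transcriptProb_nonneg (M : LinearModel K H Rmax) (L : Learner K.S K.A H T) (ω : L.Seed)
    (z : Fin T → Round K.S K.A H) : 0 ≤ M.transcriptProb L ω z :=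
  Finset.prod_nonneg fun _ _ => M.roundProb_nonneg _ _ _

theorem sum_transcriptProb (M : LinearModel K H Rmax) (L : Learner K.S K.A H T) (ω : L.Seed) :
    ∑ z, M.transcriptProb L ω z = 1 :=
  sum_prod_past_eq_one T
    (fun t past x => M.roundProb (L.play t past ω).1 (L.play t past ω).2 x)
    fun _ _ => M.sum_roundProb _ _

theorem pow_le_sum_sqrt_transcriptProb {M M' : LinearModel K H Rmax} {q : ℝ} (hq0 : 0 ≤ q)
    (hq : ∀ τ τ', q ≤ √(M.prefProb τ τ' * M'.prefProb τ τ') +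
      √((1 - M.prefProb τ τ') * (1 - M'.prefProb τ τ')))
    (L : Learner K.S K.A H T) (ω : L.Seed) :
    q ^ T ≤ ∑ z, √(M.transcriptProb L ω z * M'.transcriptProb L ω z) := by
  refine (pow_le_sum_prod_past hq0 T (fun t past x =>
    √(M.roundProb (L.play t past ω).1 (L.play t past ω).2 x *
      M'.roundProb (L.play t past ω).1 (L.play t past ω).2 x))
    (fun _ _ _ => Real.sqrt_nonneg _) fun _ _ => le_sum_sqrt_roundProb hq _ _).trans_eq ?_
  refine Finset.sum_congr rfl fun z _ => ?_
  rw [transcriptProb, transcriptProb, ← Finset.prod_mul_distrib, Real.sqrt_prod]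
  exact fun t _ => mul_nonneg (M.roundProb_nonneg _ _ _) (M'.roundProb_nonneg _ _ _)

theorem measurable_transcriptProb (M : LinearModel K H Rmax) (L : Learner K.S K.A H T)
    (z : Fin T → Round K.S K.A H) : Measurable fun ω => M.transcriptProb L ω z := by
  have hc : ∀ (s : K.S) (a : K.A), Measurable fun π : Policy K.S K.A => (π s).1 a := fun s a =>
    (measurable_pi_apply a).comp (measurable_subtype_coe.comp (measurable_pi_apply s))
  have ht : ∀ τ : Traj K.S K.A H, Measurable fun π : Policy K.S K.A => M.trajProb π τ := by
    intro τ
    simp only [trajProb_eq_prod]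
    exact Finset.measurable_prod _ fun h _ => hc _ _
  simp only [transcriptProb, roundProb_eq]
  refine Finset.measurable_prod _ fun t _ => ?_
  have hp := L.measurable_play t (fun i => z ⟨i.1, i.2.trans t.2⟩)
  exact (((ht _).comp hp.fst).mul ((ht _).comp hp.snd)).mul_const _

theorem integrable_sum_transcriptProb_mul (M : LinearModel K H Rmax) (L : Learner K.S K.A H T)
    {f : Policy K.S K.A → ℝ} (hf : Measurable f) {C : ℝ} (hC : ∀ π, |f π| ≤ C) :
    MeasureTheory.Integrable (fun ω => ∑ z, M.transcriptProb L ω z * f (L.output z ω))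
      L.seedLaw := by
  refine MeasureTheory.Integrable.of_bound (C := C) ?_ (Filter.Eventually.of_forall fun ω => ?_)
  · exact (Finset.measurable_sum _ fun z _ => (M.measurable_transcriptProb L z).mul
      (hf.comp (L.measurable_output z))).aestronglyMeasurable
  · rw [Real.norm_eq_abs]
    calc _ ≤ ∑ z, |M.transcriptProb L ω z * f (L.output z ω)| := Finset.abs_sum_le_sum_abs _ _
      _ ≤ ∑ z, M.transcriptProb L ω z * C := Finset.sum_le_sum fun z _ => by
        rw [abs_mul, abs_of_nonneg (M.transcriptProb_nonneg L ω z)]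
        exact mul_le_mul_of_nonneg_left (hC _) (M.transcriptProb_nonneg L ω z)
      _ = C := by rw [← Finset.sum_mul, sum_transcriptProb, one_mul]

theorem outputExp_mono (M : LinearModel K H Rmax) (L : Learner K.S K.A H T)
    {f g : Policy K.S K.A → ℝ} (hf : Measurable f) (hg : Measurable g) {C D : ℝ}
    (hC : ∀ π, |f π| ≤ C) (hD : ∀ π, |g π| ≤ D) (hfg : ∀ π, f π ≤ g π) :
    M.outputExp L f ≤ M.outputExp L g :=
  MeasureTheory.integral_mono (M.integrable_sum_transcriptProb_mul L hf hC)
    (M.integrable_sum_transcriptProb_mul L hg hD) fun ω => Finset.sum_le_sum fun z _ =>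
      mul_le_mul_of_nonneg_left (hfg _) (M.transcriptProb_nonneg L ω z)

theorem outputExp_mul_add (M : LinearModel K H Rmax) (L : Learner K.S K.A H T)
    {f : Policy K.S K.A → ℝ} (hf : Measurable f) {C : ℝ} (hC : ∀ π, |f π| ≤ C) (a b : ℝ) :
    M.outputExp L (fun π => a * f π + b) = a * M.outputExp L f + b := by
  have h : ∀ ω, ∑ z, M.transcriptProb L ω z * (a * f (L.output z ω) + b) =
      a * ∑ z, M.transcriptProb L ω z * f (L.output z ω) + b := fun ω => by
    simp only [mul_add, Finset.sum_add_distrib, ← Finset.sum_mul, sum_transcriptProb, one_mul,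
      Finset.mul_sum]
    congr 1
    exact Finset.sum_congr rfl fun z _ => by ring
  simp only [outputExp, h]
  rw [MeasureTheory.integral_add ((M.integrable_sum_transcriptProb_mul L hf hC).const_mul a)
    (MeasureTheory.integrable_const b), MeasureTheory.integral_const_mul]
  simp

/-- On the compact policy space this supplies the maximizer, as well as boundedness and
measurability of the gap. -/
theorem continuous_J (M : LinearModel K H Rmax) (β : ℝ) : Continuous (M.J β) := by
  have hc : ∀ a : K.A, Continuous fun π : Policy K.S K.A => (π default).1 a := fun a =>
    (continuous_apply a).comp (continuous_subtype_val.comp (continuous_apply default))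
  have hkl : Continuous fun π : Policy K.S K.A => klFinite (π default) (K.πref default) := by
    refine continuous_finsetSum _ fun a _ => ?_
    have hq := (K.πref_pos default a).ne'
    -- Writing p log(p/q) as q · (x log x) at x = p/q gives continuity also at p = 0.
    have := (Real.continuous_mul_log.comp ((hc a).div_const ((K.πref default).1 a))).const_mul
      ((K.πref default).1 a)
    refine this.congr fun π => ?_
    simp only [Function.comp_apply]
    field_simp
  have : M.J β = fun π => H * ∑ a, (π default).1 a * M.reward default a -
      β * (H * klFinite (π default) (K.πref default)) := funext (M.J_eq β)
  rw [this]
  have h1 : Continuous fun π : Policy K.S K.A => ∑ a, (π default).1 a * M.reward default a :=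
    continuous_finsetSum _ fun a _ => (hc a).mul_const _
  exact (h1.const_mul _).sub ((hkl.const_mul _).const_mul _)

end SingleState

end LinearModel

/-! ### Relative entropy -/

/-- Termwise p log(p/q) ≥ p - q, from log x ≥ 1 - 1/x. -/
theorem klFinite_nonneg {A : Type} [Fintype A] (p q : stdSimplex ℝ A) (hq : ∀ a, 0 < q.1 a) :
    0 ≤ klFinite p q := by
  have h : ∑ a, (p.1 a - q.1 a) ≤ klFinite p q := Finset.sum_le_sum fun a _ => by
    rcases (p.2.1 a).eq_or_lt with h0 | h0
    · rw [← h0]; simpa using (hq a).le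
    · have h1 := Real.one_sub_inv_le_log_of_pos (div_pos h0 (hq a))
      have h2 := mul_le_mul_of_nonneg_left h1 h0.le
      rw [inv_div, mul_sub, mul_one, mul_div_cancel₀ _ h0.ne'] at h2
      exact h2
  rwa [Finset.sum_sub_distrib, p.2.2, q.2.2, sub_self] at h

theorem klFinite_single {A : Type} [Fintype A] [DecidableEq A] (a : A) (q : stdSimplex ℝ A) :
    klFinite ⟨Pi.single a 1, single_mem_stdSimplex ℝ a⟩ q = -Real.log (q.1 a) := by
  rw [klFinite, Finset.sum_eq_single a]
  · simp
  · intro b _ hb; simp [hb]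
  · simp

/-! ### Assouad's lemma -/

/-- The sign vector's neighbour in the Hamming cube that differs in coordinate `i`. -/
def flipBit {n : ℕ} (i : Fin n) (σ : Fin n → Bool) : Fin n → Bool :=
  Function.update σ i (!σ i)

theorem flipBit_same {n : ℕ} (i : Fin n) (σ : Fin n → Bool) : flipBit i σ i = !σ i := by
  simp [flipBit]

theorem flipBit_of_ne {n : ℕ} {i j : Fin n} (h : j ≠ i) (σ : Fin n → Bool) :
    flipBit i σ j = σ j := by
  simp [flipBit, h]

theorem flipBit_involutive {n : ℕ} (i : Fin n) : Function.Involutive (flipBit i) := by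
  intro σ
  simp [flipBit]

/-- Assouad's lemma on the Hamming cube, for `[0,1]`-valued tests. -/
theorem assouad {n : ℕ} {Z : Type*} [Fintype Z] (P : (Fin n → Bool) → Z → ℝ)
    (hP : ∀ σ z, 0 ≤ P σ z) (hP1 : ∀ σ, ∑ z, P σ z = 1) (W : Fin n → Bool → Z → ℝ)
    (hW : ∀ i b z, 0 ≤ W i b z) (hflip : ∀ i b z, W i (!b) z = 1 - W i b z) {c : ℝ} (hc : 0 ≤ c)
    (haff : ∀ σ i, c ≤ ∑ z, √(P σ z * P (flipBit i σ) z)) :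
    2 ^ n * (n * (c ^ 2 / 4)) ≤ ∑ σ, ∑ z, P σ z * ∑ i, W i (σ i) z := by
  have hpair : ∀ i σ, c ^ 2 / 2 ≤ ∑ z, P σ z * W i (σ i) z +
      ∑ z, P (flipBit i σ) z * W i (flipBit i σ i) z := by
    intro i σ
    have h1 := sq_sum_sqrt_mul_le (P σ) (P (flipBit i σ)) (hP _) (hP _) (hP1 _) (hP1 _)
    have h2 := sum_min_le_test (P σ) (P (flipBit i σ)) (W i (σ i)) (hW i _)
      fun z => by linarith [hflip i (σ i) z, hW i (!σ i) z]
    have h3 := pow_le_pow_left₀ hc (haff σ i) 2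
    simp only [flipBit_same, hflip]
    linarith
  have hcoord : ∀ i, 2 ^ n * (c ^ 2 / 4) ≤ ∑ σ, ∑ z, P σ z * W i (σ i) z := by
    intro i
    have h1 := Finset.sum_le_sum fun σ (_ : σ ∈ Finset.univ) => hpair i σ
    -- Flipping permutes the cube, so both halves of the pair bound have the same sum over σ; this
    -- halves c²/2 to c²/4.
    rw [Finset.sum_add_distrib, (flipBit_involutive i).bijective.sum_comp
      (fun σ => ∑ z, P σ z * W i (σ i) z)] at h1
    simp only [Finset.sum_const, Finset.card_univ, Fintype.card_fun, Fintype.card_bool,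
      Fintype.card_fin, nsmul_eq_mul, Nat.cast_pow, Nat.cast_ofNat] at h1
    linarith
  calc _ = ∑ i : Fin n, 2 ^ n * (c ^ 2 / 4) := by
        simp only [Finset.sum_const, Finset.card_univ, Fintype.card_fin, nsmul_eq_mul]; ring
    _ ≤ ∑ i, ∑ σ, ∑ z, P σ z * W i (σ i) z := Finset.sum_le_sum fun i _ => hcoord i
    _ = _ := by
        rw [Finset.sum_comm]
        refine Finset.sum_congr rfl fun σ _ => ?_
        rw [Finset.sum_comm]
        simp only [Finset.mul_sum]

/-! ### The hypercube instance -/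

/-- The sign of a bit. -/
def bitSign (b : Bool) : ℝ := if b then 1 else -1

theorem bitSign_mul_self (b : Bool) : bitSign b * bitSign b = 1 := by
  cases b <;> simp [bitSign]

theorem one_add_bitSign_mul (b b' : Bool) :
    1 + bitSign b * bitSign b' = 2 * if b = b' then 1 else 0 := by
  cases b <;> cases b' <;> norm_num [bitSign]

/-- The feature vector `(1/√2, ±1/√(2n), …, ±1/√(2n))`. -/
noncomputable def cubeFeature (n : ℕ) (a : Fin n → Bool) : EuclideanSpace ℝ (Fin (n + 1)) :=
  WithLp.toLp 2 (Fin.cons (√2)⁻¹ fun i => (√(2 * n))⁻¹ * bitSign (a i))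

/-- The uniform distribution on the Hamming cube. -/
noncomputable def cubeUniform (n : ℕ) : stdSimplex ℝ (Fin n → Bool) :=
  ⟨fun _ => (2 ^ n)⁻¹, fun _ => by positivity, by simp⟩

theorem norm_cubeFeature_le (n : ℕ) (a : Fin n → Bool) : ‖cubeFeature n a‖ ≤ 1 := by
  rw [← sq_le_one_iff₀ (norm_nonneg _), EuclideanSpace.real_norm_sq_eq, Fin.sum_univ_succ]
  simp only [cubeFeature, Fin.cons_zero, Fin.cons_succ, mul_pow, inv_pow]
  have h : ∀ b, bitSign b ^ 2 = 1 := fun b => by rw [sq, bitSign_mul_self]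
  rw [Real.sq_sqrt (by positivity), Real.sq_sqrt (by positivity)]
  simp only [h, mul_one, Finset.sum_const, Finset.card_univ, Fintype.card_fin, nsmul_eq_mul]
  rcases n.eq_zero_or_pos with rfl | hn
  · norm_num
  · have : (0 : ℝ) < n := by exact_mod_cast hn
    field_simp
    norm_num

/-- The single-state decision problem whose actions are the vertices of the Hamming cube. -/
@[reducible] noncomputable def hypercubeData (n : ℕ) : KnownData (n + 1) where
  S := Unit
  A := Fin n → Bool
  φ _ a := cubeFeature n a
  norm_φ_le _ a := norm_cubeFeature_le n a
  ρ := ⟨fun _ => 1, fun _ => zero_le_one, by simp⟩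
  πref _ := cubeUniform n
  πref_pos _ _ := by simp [cubeUniform]

/-- The reward parameter under which an action earns `2κ` for each coordinate that agrees
with `σ`. -/
noncomputable def cubeParam (n : ℕ) (κ : ℝ) (σ : Fin n → Bool) : EuclideanSpace ℝ (Fin (n + 1)) :=
  WithLp.toLp 2 (Fin.cons (√2 * (κ * n)) fun i => √(2 * n) * (κ * bitSign (σ i)))

theorem norm_cubeParam (n : ℕ) {κ : ℝ} (hκ : 0 ≤ κ) (σ : Fin n → Bool) :
    ‖cubeParam n κ σ‖ = 2 * κ * n := by
  rw [← sq_eq_sq₀ (norm_nonneg _) (by positivity), EuclideanSpace.real_norm_sq_eq,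
    Fin.sum_univ_succ]
  simp only [cubeParam, Fin.cons_zero, Fin.cons_succ, mul_pow]
  have h : ∀ b, bitSign b ^ 2 = 1 := fun b => by rw [sq, bitSign_mul_self]
  rw [Real.sq_sqrt (by positivity), Real.sq_sqrt (by positivity)]
  simp only [h, mul_one, Finset.sum_const, Finset.card_univ, Fintype.card_fin, nsmul_eq_mul]
  ring

/-- The first coordinate contributes κn, exactly the offset that turns the sum of ±κ into a
nonnegative count of agreements. -/
theorem inner_cubeFeature_cubeParam {n : ℕ} (hn : 0 < n) (κ : ℝ) (a σ : Fin n → Bool) :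
    inner ℝ (cubeFeature n a) (cubeParam n κ σ) =
      2 * κ * ∑ i, if a i = σ i then (1 : ℝ) else 0 := by
  have h0 : (√(2 * n)) ≠ 0 := by positivity
  have h2 : √2 ≠ 0 := by positivity
  have h1 : ∀ i, √(2 * n) * (κ * bitSign (σ i)) * ((√(2 * n))⁻¹ * bitSign (a i)) =
      κ * (bitSign (a i) * bitSign (σ i)) := fun i => by field_simp
  have h3 : ∀ i, κ * (bitSign (a i) * bitSign (σ i)) =
      κ * (2 * if a i = σ i then 1 else 0) - κ := fun i => by
    rw [← one_add_bitSign_mul]; ring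
  simp only [PiLp.inner_apply, RCLike.inner_apply, conj_trivial, Fin.sum_univ_succ, cubeFeature,
    cubeParam, Fin.cons_zero, Fin.cons_succ]
  simp only [h1, h3, Finset.sum_sub_distrib, ← Finset.mul_sum, Finset.sum_const, Finset.card_univ,
    Fintype.card_fin, nsmul_eq_mul]
  field_simp
  ring

theorem inner_cubeFeature_const (n : ℕ) (a : Fin n → Bool) :
    inner ℝ (cubeFeature n a) (WithLp.toLp 2 (Fin.cons √2 0) : EuclideanSpace ℝ (Fin (n + 1))) =
      1 := by
  simp [PiLp.inner_apply, Fin.sum_univ_succ, cubeFeature]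

theorem sum_agree_mem {n : ℕ} (a σ : Fin n → Bool) :
    (∑ i, if a i = σ i then (1 : ℝ) else 0) ∈ Set.Icc (0 : ℝ) n := by
  constructor
  · exact Finset.sum_nonneg fun i _ => by split_ifs <;> norm_num
  · calc _ ≤ ∑ i : Fin n, (1 : ℝ) := Finset.sum_le_sum fun i _ => by split_ifs <;> norm_num
      _ = n := by simp

/-- The linear model on the Hamming cube with hidden vertex `σ`. -/
noncomputable def hypercubeModel {n : ℕ} (hn : 0 < n) (H : ℕ) {Rmax κ : ℝ} (hκ : 0 ≤ κ)
    (hκ1 : 2 * κ * n ≤ 1) (hκR : H * (2 * κ * n) ≤ Rmax) (σ : Fin n → Bool) :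
    LinearModel (hypercubeData n) H Rmax where
  μ _ := WithLp.toLp 2 (Fin.cons √2 0)
  ν := cubeParam n κ σ
  norm_sum_μ_le := by
    rw [Fintype.sum_unique, EuclideanSpace.norm_eq, Fin.sum_univ_succ]
    refine Real.sqrt_le_sqrt ?_
    -- The vector has norm √2, which is at most √(n+1) because n ≥ 1.
    have : (1 : ℝ) ≤ n := by exact_mod_cast hn
    simp
    linarith
  norm_ν_le := by rwa [norm_cubeParam n hκ]
  trans_nonneg _ a _ := by rw [inner_cubeFeature_const]; exact zero_le_one
  trans_sum _ a := by rw [Fintype.sum_unique, inner_cubeFeature_const]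
  reward_mem τ := by
    simp only [inner_cubeFeature_cubeParam hn]
    constructor
    · exact Finset.sum_nonneg fun h _ => mul_nonneg (by positivity) (sum_agree_mem _ _).1
    · refine le_trans ?_ hκR
      calc _ ≤ ∑ h : Fin H, 2 * κ * n := Finset.sum_le_sum fun h _ =>
            mul_le_mul_of_nonneg_left (sum_agree_mem _ _).2 (by positivity)
        _ = _ := by simp

/-! ### Indistinguishability of neighbours and cost of missed bits -/

section Hypercube

variable {n H T : ℕ} {Rmax κ : ℝ}

theorem hypercubeModel_reward (hn : 0 < n) (hκ : 0 ≤ κ) (hκ1 : 2 * κ * n ≤ 1)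
    (hκR : H * (2 * κ * n) ≤ Rmax) (σ : Fin n → Bool) (s : Unit) (a : Fin n → Bool) :
    (hypercubeModel hn H hκ hκ1 hκR σ).reward s a =
      2 * κ * ∑ i, if a i = σ i then (1 : ℝ) else 0 :=
  inner_cubeFeature_cubeParam hn κ a σ

theorem abs_sum_agree_sub_le (a σ : Fin n → Bool) (i : Fin n) :
    |(∑ j, if a j = σ j then (1 : ℝ) else 0) - ∑ j, if a j = flipBit i σ j then (1 : ℝ) else 0|
      ≤ 1 := by
  rw [← Finset.sum_sub_distrib, Finset.sum_eq_single i]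
  · split_ifs <;> norm_num
  · intro j _ hj
    rw [flipBit_of_ne hj, sub_self]
  · simp

theorem abs_trajReward_sub_le (hn : 0 < n) (hκ : 0 ≤ κ) (hκ1 : 2 * κ * n ≤ 1)
    (hκR : H * (2 * κ * n) ≤ Rmax) (σ : Fin n → Bool) (i : Fin n)
    (τ : Traj Unit (Fin n → Bool) H) :
    |(hypercubeModel hn H hκ hκ1 hκR σ).trajReward τ -
      (hypercubeModel hn H hκ hκ1 hκR (flipBit i σ)).trajReward τ| ≤ H * (2 * κ) := by
  simp only [LinearModel.trajReward, hypercubeModel_reward, ← Finset.sum_sub_distrib, ← mul_sub]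
  refine (Finset.abs_sum_le_sum_abs _ _).trans ?_
  calc _ ≤ ∑ h : Fin H, 2 * κ := Finset.sum_le_sum fun h _ => by
        rw [abs_mul, abs_of_nonneg (by positivity : 0 ≤ 2 * κ)]
        have := abs_sum_agree_sub_le (τ h).2 σ i
        rw [← Finset.sum_sub_distrib] at this
        exact mul_le_of_le_one_right (by positivity) this
    _ = _ := by simp

/-- Each of the two trajectory rewards moves by at most 2Hκ, hence their difference by at most 4Hκ,
and (4Hκ)²/32 = (Hκ)²/2. -/
theorem exp_le_affinity_hypercubeModel (hn : 0 < n) (hκ : 0 ≤ κ) (hκ1 : 2 * κ * n ≤ 1)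
    (hκR : H * (2 * κ * n) ≤ Rmax) (σ : Fin n → Bool) (i : Fin n)
    (τ τ' : Traj Unit (Fin n → Bool) H) :
    Real.exp (-(H * κ) ^ 2 / 2) ≤
      √((hypercubeModel hn H hκ hκ1 hκR σ).prefProb τ τ' *
          (hypercubeModel hn H hκ hκ1 hκR (flipBit i σ)).prefProb τ τ') +
        √((1 - (hypercubeModel hn H hκ hκ1 hκR σ).prefProb τ τ') *
          (1 - (hypercubeModel hn H hκ hκ1 hκR (flipBit i σ)).prefProb τ τ')) := by
  refine le_trans (Real.exp_le_exp.2 ?_) (exp_le_affinity _ _ _ _)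
  have h1 := abs_le.1 (abs_trajReward_sub_le hn hκ hκ1 hκR σ i τ)
  have h2 := abs_le.1 (abs_trajReward_sub_le hn hκ hκ1 hκR σ i τ')
  have h3 : ((hypercubeModel hn H hκ hκ1 hκR σ).trajReward τ -
      (hypercubeModel hn H hκ hκ1 hκR σ).trajReward τ' -
      ((hypercubeModel hn H hκ hκ1 hκR (flipBit i σ)).trajReward τ -
      (hypercubeModel hn H hκ hκ1 hκR (flipBit i σ)).trajReward τ')) ^ 2 ≤ (4 * (H * κ)) ^ 2 :=
    sq_le_sq' (by linarith) (by linarith)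
  linarith

/-- Probability that coordinate `i` of the action differs from `b`. -/
noncomputable def missProb (i : Fin n) (b : Bool) (π : Policy Unit (Fin n → Bool)) : ℝ :=
  ∑ a, (π default).1 a * if a i = b then 0 else 1

/-- Expected Hamming distance of the action to `σ`. -/
noncomputable def missCount (σ : Fin n → Bool) (π : Policy Unit (Fin n → Bool)) : ℝ :=
  ∑ i, missProb i (σ i) π

theorem missProb_nonneg (i : Fin n) (b : Bool) (π : Policy Unit (Fin n → Bool)) :
    0 ≤ missProb i b π :=
  Finset.sum_nonneg fun a _ => mul_nonneg ((π default).2.1 a) (by split_ifs <;> norm_num)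

/-- This complementarity makes the returned policy a randomized test for bit `i`, as `assouad`
requires. -/
theorem missProb_not (i : Fin n) (b : Bool) (π : Policy Unit (Fin n → Bool)) :
    missProb i (!b) π = 1 - missProb i b π := by
  rw [eq_sub_iff_add_eq, missProb, missProb, ← Finset.sum_add_distrib]
  refine Eq.trans ?_ (π default).2.2
  refine Finset.sum_congr rfl fun a _ => ?_
  rw [← mul_add]
  cases a i <;> cases b <;> simp

theorem missCount_mem (σ : Fin n → Bool) (π : Policy Unit (Fin n → Bool)) :
    missCount σ π ∈ Set.Icc (0 : ℝ) n := by
  constructor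
  · exact Finset.sum_nonneg fun i _ => missProb_nonneg _ _ _
  · calc _ ≤ ∑ i : Fin n, (1 : ℝ) := Finset.sum_le_sum fun i _ => by
          linarith [missProb_not i (σ i) π, missProb_nonneg i (!σ i) π]
      _ = n := by simp

theorem measurable_missCount (σ : Fin n → Bool) : Measurable (missCount σ) := by
  refine Finset.measurable_sum _ fun i _ => Finset.measurable_sum _ fun a _ => ?_
  exact ((measurable_pi_apply a).comp
    (measurable_subtype_coe.comp (measurable_pi_apply default))).mul_const _

theorem sum_mul_agree (σ : Fin n → Bool) (π : Policy Unit (Fin n → Bool)) :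
    ∑ a, (π default).1 a * ∑ i, (if a i = σ i then (1 : ℝ) else 0) = n - missCount σ π := by
  have h : ∀ a : Fin n → Bool, ∑ i, (if a i = σ i then (1 : ℝ) else 0) =
      n - ∑ i, if a i = σ i then (0 : ℝ) else 1 := fun a => by
    rw [eq_sub_iff_add_eq, ← Finset.sum_add_distrib]
    have : ∀ i, ((if a i = σ i then (1 : ℝ) else 0) + if a i = σ i then (0 : ℝ) else 1) = 1 :=
      fun i => by split_ifs <;> norm_num
    simp [this]
  simp only [h, mul_sub, Finset.sum_sub_distrib, ← Finset.sum_mul]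
  rw [show ∑ a, (π default).1 a = 1 from (π default).2.2, one_mul]
  simp only [missCount, missProb, Finset.mul_sum]
  rw [Finset.sum_comm]

variable [NeZero H]

theorem hypercubeModel_J (hn : 0 < n) (hκ : 0 ≤ κ) (hκ1 : 2 * κ * n ≤ 1)
    (hκR : H * (2 * κ * n) ≤ Rmax) (σ : Fin n → Bool) (β : ℝ)
    (π : Policy Unit (Fin n → Bool)) :
    (hypercubeModel hn H hκ hκ1 hκR σ).J β π = H * (2 * κ) * (n - missCount σ π) -
      β * (H * klFinite (π default) (cubeUniform n)) := by
  rw [LinearModel.J_eq]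
  simp only [hypercubeModel_reward]
  rw [← sum_mul_agree σ π]
  simp only [Finset.mul_sum]
  congr 1
  exact Finset.sum_congr rfl fun a _ => Finset.sum_congr rfl fun i _ => by ring

/-- The optimality gap dominates the expected Hamming distance, up to the regularization. -/
theorem le_J_sub_J (hn : 0 < n) (hκ : 0 ≤ κ) (hκ1 : 2 * κ * n ≤ 1)
    (hκR : H * (2 * κ * n) ≤ Rmax) (σ : Fin n → Bool) {β : ℝ} (hβ : 0 ≤ β)
    {πstar : Policy Unit (Fin n → Bool)}
    (hstar : ∀ π, (hypercubeModel hn H hκ hκ1 hκR σ).J β π ≤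
      (hypercubeModel hn H hκ hκ1 hκR σ).J β πstar) (π : Policy Unit (Fin n → Bool)) :
    H * (2 * κ) * missCount σ π - β * (H * n) ≤
      (hypercubeModel hn H hκ hκ1 hκR σ).J β πstar -
        (hypercubeModel hn H hκ hκ1 hκR σ).J β π := by
  -- The comparison policy always plays σ: it misses no bit and has entropy cost n log 2 ≤ n per
  -- step.
  have h1 := hstar fun _ => ⟨Pi.single σ 1, single_mem_stdSimplex ℝ σ⟩
  have h2 : missCount σ (fun _ => ⟨Pi.single σ 1, single_mem_stdSimplex ℝ σ⟩) = 0 := by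
    refine Finset.sum_eq_zero fun i _ => ?_
    rw [missProb, Finset.sum_eq_single σ]
    · simp
    · intro b _ hb; simp [hb]
    · simp
  rw [hypercubeModel_J, h2, klFinite_single] at h1
  rw [hypercubeModel_J hn hκ hκ1 hκR σ β π]
  have h3 : β * (H * -Real.log ((cubeUniform n).1 σ)) ≤ β * (H * n) := by
    refine mul_le_mul_of_nonneg_left (mul_le_mul_of_nonneg_left ?_ (Nat.cast_nonneg _)) hβ
    rw [cubeUniform, Real.log_inv, neg_neg, Real.log_pow]
    exact mul_le_of_le_one_right (Nat.cast_nonneg _)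
      (by linarith [Real.log_le_sub_one_of_pos (zero_lt_two' ℝ)])
  have h4 : 0 ≤ β * (H * klFinite (π default) (cubeUniform n)) :=
    mul_nonneg hβ (mul_nonneg (Nat.cast_nonneg _)
      (klFinite_nonneg _ _ fun a => (hypercubeData n).πref_pos default a))
  linarith

/-- Assouad's bound holds for every seed. Integrating over the seed and averaging over σ, some
vertex attains at least the mean. -/
theorem exists_le_outputExp_missCount (hn : 0 < n) (hκ : 0 ≤ κ)
    (hκ1 : 2 * κ * n ≤ 1) (hκR : H * (2 * κ * n) ≤ Rmax) (hκT : 4 * T * (H * κ) ^ 2 ≤ 1)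
    (L : Learner Unit (Fin n → Bool) H T) :
    ∃ σ, 3 / 16 * (n : ℝ) ≤
      (hypercubeModel hn H hκ hκ1 hκR σ).outputExp L (missCount σ) := by
  set M := hypercubeModel hn H hκ hκ1 hκR with hM
  have haff : ∀ ω σ i, Real.exp (-1 / 8) ≤
      ∑ z, √((M σ).transcriptProb L ω z * (M (flipBit i σ)).transcriptProb L ω z) := by
    intro ω σ i
    have h := LinearModel.pow_le_sum_sqrt_transcriptProb (M := M σ) (M' := M (flipBit i σ))
      (q := Real.exp (-(H * κ) ^ 2 / 2)) (Real.exp_pos _).le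
      (exp_le_affinity_hypercubeModel hn hκ hκ1 hκR σ i) L ω
    refine le_trans ?_ h
    rw [← Real.exp_nat_mul, Real.exp_le_exp]
    linarith
  -- Here exp(-1/4) ≥ 3/4.
  have hconst : 3 / 16 ≤ Real.exp (-1 / 8) ^ 2 / 4 := by
    rw [← Real.exp_nat_mul]
    have := Real.add_one_le_exp ((2 : ℕ) * (-1 / 8 : ℝ))
    push_cast at this ⊢
    linarith
  have hω : ∀ ω, 2 ^ n * (3 / 16 * (n : ℝ)) ≤
      ∑ σ, ∑ z, (M σ).transcriptProb L ω z * missCount σ (L.output z ω) := by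
    intro ω
    refine le_trans ?_ (assouad (fun σ z => (M σ).transcriptProb L ω z)
      (fun σ z => (M σ).transcriptProb_nonneg L ω z) (fun σ => (M σ).sum_transcriptProb L ω)
      (fun i b z => missProb i b (L.output z ω)) (fun _ _ _ => missProb_nonneg _ _ _)
      (fun _ _ _ => missProb_not _ _ _) (Real.exp_pos _).le (haff ω))
    rw [mul_comm (3 / 16 : ℝ)]
    gcongr
  have hint : ∀ σ, MeasureTheory.Integrable (fun ω => ∑ z, (M σ).transcriptProb L ω z *
      missCount σ (L.output z ω)) L.seedLaw := fun σ =>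
    (M σ).integrable_sum_transcriptProb_mul L (measurable_missCount σ) (C := n) fun π => by
      rw [abs_of_nonneg (missCount_mem σ π).1]; exact (missCount_mem σ π).2
  have hsum : 2 ^ n * (3 / 16 * (n : ℝ)) ≤ ∑ σ, (M σ).outputExp L (missCount σ) := by
    simp only [LinearModel.outputExp]
    rw [← MeasureTheory.integral_finsetSum _ fun σ _ => hint σ]
    calc _ = ∫ _, 2 ^ n * (3 / 16 * (n : ℝ)) ∂L.seedLaw := by simp
      _ ≤ _ := MeasureTheory.integral_mono (MeasureTheory.integrable_const _)
        (MeasureTheory.integrable_finsetSum _ fun σ _ => hint σ) hω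
  obtain ⟨σ, -, h⟩ := Finset.exists_le_of_sum_le (s := Finset.univ)
    (f := fun _ : Fin n → Bool => 3 / 16 * (n : ℝ))
    (g := fun σ => (M σ).outputExp L (missCount σ)) Finset.univ_nonempty (by simpa using hsum)
  exact ⟨σ, h⟩

end Hypercube

/-! ### Choice of parameters and conclusion -/

theorem theorem3 :
    ∃ c : ℝ, 0 < c ∧
      ∀ (d H T : ℕ) (Rmax : ℝ) [NeZero H], 2 ≤ d →
        (d : ℝ) ≤ H * Real.sqrt T → (d : ℝ) ≤ Rmax * Real.sqrt T →
        ∀ alg : OnlineAlgorithm d H T,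
          ∃ (K : KnownData d) (M : LinearModel K H Rmax) (β : ℝ) (πstar : Policy K.S K.A),
            0 < β ∧
            (∀ π : Policy K.S K.A, M.J β π ≤ M.J β πstar) ∧
            c * Real.sqrt ((d : ℝ) ^ 2 / T) ≤
              M.outputExp (alg K β) (fun πhat => M.J β πstar - M.J β πhat) ∧
            c ≤ M.outputProb (alg K β)
              {πhat | c * Real.sqrt ((d : ℝ) ^ 2 / T) ≤ M.J β πstar - M.J β πhat} := by
  refine ⟨1 / 32, by norm_num, ?_⟩
  intro d H T Rmax _ hd hdH hdR alg
  obtain ⟨n, rfl⟩ : ∃ n, d = n + 1 := ⟨d - 1, by omega⟩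
  have hn : 0 < n := by omega
  have hn1 : (1 : ℝ) ≤ n := by exact_mod_cast hn
  -- For T = 0 the assumption `hdH` would read d ≤ 0.
  have hT : 0 < T := by
    rcases T.eq_zero_or_pos with rfl | h
    · norm_num at hdH; linarith
    · exact h
  push_cast at hdH hdR
  have hH : (0 : ℝ) < H := by exact_mod_cast Nat.pos_of_ne_zero (NeZero.ne H)
  have hs : 0 < √(T : ℝ) := Real.sqrt_pos.2 (by exact_mod_cast hT)
  -- The largest κ with 4T(Hκ)² ≤ 1. The two bounds on d then keep the parameter in the unit ball
  -- and the total reward below `Rmax`.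
  set κ : ℝ := 1 / (2 * H * √T) with hκdef
  have hκ : 0 ≤ κ := by positivity
  have hHκ : H * (2 * κ) = 1 / √T := by rw [hκdef]; field_simp
  have hκ1 : 2 * κ * n ≤ 1 := by
    have : 2 * κ * n = n / (H * √T) := by rw [hκdef]; field_simp
    rw [this]
    exact div_le_one_of_le₀ (by linarith) (by positivity)
  have hκR : H * (2 * κ * n) ≤ Rmax := by
    rw [← mul_assoc, hHκ, one_div_mul_eq_div, div_le_iff₀ hs]
    linarith
  have hκT : 4 * T * (H * κ) ^ 2 ≤ 1 := by
    have h1 : H * κ = 1 / (2 * √T) := by rw [hκdef]; field_simp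
    have hT' : (0 : ℝ) < T := by exact_mod_cast hT
    rw [h1, div_pow, mul_pow, Real.sq_sqrt hT'.le]
    refine le_of_eq ?_
    field_simp
    norm_num
  -- The entropy allowance βHn becomes n/(16√T), a third of the 3n/(16√T) lost through missed bits.
  set β : ℝ := 1 / (16 * H * √T) with hβdef
  have hβ : 0 < β := by positivity
  have hβH : β * (H * n) = n / (16 * √T) := by rw [hβdef]; field_simp
  set L := alg (hypercubeData n) β with hL
  obtain ⟨σ, hσ⟩ := exists_le_outputExp_missCount hn hκ hκ1 hκR hκT L
  set M := hypercubeModel hn H hκ hκ1 hκR σ with hM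
  have : CompactSpace (stdSimplex ℝ (Fin n → Bool)) :=
    isCompact_iff_compactSpace.1 (isCompact_stdSimplex ℝ _)
  have : Nonempty (Policy Unit (Fin n → Bool)) := ⟨(hypercubeData n).πref⟩
  have hJ : Continuous (M.J β) := M.continuous_J β
  obtain ⟨πstar, -, hstar⟩ := isCompact_univ.exists_isMaxOn Set.univ_nonempty hJ.continuousOn
  replace hstar : ∀ π, M.J β π ≤ M.J β πstar := fun π => hstar (Set.mem_univ π)
  have hgapc : Continuous fun π => M.J β πstar - M.J β π := continuous_const.sub hJ
  obtain ⟨B, hB⟩ := isCompact_univ.exists_bound_of_continuousOn hgapc.continuousOn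
  have hB : ∀ π, |M.J β πstar - M.J β π| ≤ B := fun π => hB π (Set.mem_univ π)
  have hgap : ∀ π, 1 / √T * missCount σ π - n / (16 * √T) ≤ M.J β πstar - M.J β π := fun π => by
    rw [← hHκ, ← hβH]
    exact le_J_sub_J hn hκ hκ1 hκR σ hβ.le hstar π
  have hmC : ∀ π, |missCount σ π| ≤ n := fun π => by
    rw [abs_of_nonneg (missCount_mem σ π).1]; exact (missCount_mem σ π).2
  have hmB : ∀ a b π, |a * missCount σ π + b| ≤ |a| * n + |b| := fun a b π =>
    (abs_add_le _ _).trans (by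
      rw [abs_mul]
      gcongr
      exact hmC π)
  have hmm : ∀ a b : ℝ, Measurable fun π => a * missCount σ π + b := fun a b =>
    ((measurable_missCount σ).const_mul a).add_const b
  -- Uses d = n + 1 ≤ 2n.
  have hε : 1 / 32 * √((((n + 1 : ℕ) : ℝ)) ^ 2 / T) ≤ n / (16 * √T) := by
    rw [Real.sqrt_div (by positivity), Real.sqrt_sq (by positivity), div_mul_div_comm,
      div_le_div_iff₀ (by positivity) (by positivity)]
    push_cast
    nlinarith
  refine ⟨hypercubeData n, M, β, πstar, hβ, hstar, ?_, ?_⟩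
  · have h1 := M.outputExp_mono L (hmm (1 / √T) (-(n / (16 * √T)))) hgapc.measurable
      (hmB _ _) hB fun π => by linarith [hgap π]
    rw [M.outputExp_mul_add L (measurable_missCount σ) hmC] at h1
    refine le_trans ?_ h1
    have h2 : 1 / √T * (3 / 16 * n) ≤ 1 / √T * M.outputExp L (missCount σ) := by gcongr
    have h3 : 1 / √T * (3 / 16 * n) = 3 * (n / (16 * √T)) := by field_simp
    have h4 : 0 ≤ n / (16 * √(T : ℝ)) := by positivity
    linarith
  · set E := {πhat | 1 / 32 * √((((n + 1 : ℕ) : ℝ)) ^ 2 / T) ≤ M.J β πstar - M.J β πhat} with hE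
    have hEm : MeasurableSet E := measurableSet_le measurable_const hgapc.measurable
    -- Reverse Markov: `missCount`/n - 1/8 lies below the indicator of `E`, since off `E` at most
    -- n/8 bits are missed on average. Its mean is at least 3/16 - 1/8 = 1/16.
    have h1 := M.outputExp_mono L (hmm (1 / n) (-(1 / 8))) (g := E.indicator 1)
      (measurable_one.indicator hEm) (hmB _ _) (D := 1)
      (fun π => by by_cases h : π ∈ E <;> simp [h]) fun π => by
        by_cases h : π ∈ E
        · have h2 := (missCount_mem σ π).2
          have h3 : 1 / n * missCount σ π ≤ 1 := by
            rw [one_div_mul_eq_div]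
            exact div_le_one_of_le₀ h2 (by positivity)
          simp only [Set.indicator_of_mem h, Pi.one_apply]
          linarith
        · rw [Set.indicator_of_notMem h]
          have h2 : M.J β πstar - M.J β π < n / (16 * √T) := (not_le.1 h).trans_le hε
          have h3 : 1 / √T * missCount σ π < 1 / √T * (n / 8) := by
            have : 1 / √T * (n / 8) = 2 * (n / (16 * √T)) := by field_simp; norm_num
            linarith [hgap π]
          have h4 := (mul_lt_mul_iff_right₀ (by positivity)).1 h3
          have h5 : 1 / n * missCount σ π ≤ 1 / 8 := by
            rw [one_div_mul_eq_div, div_le_iff₀ (by positivity)]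
            linarith
          linarith
    rw [M.outputExp_mul_add L (measurable_missCount σ) hmC] at h1
    refine le_trans ?_ h1
    have h2 : 1 / (n : ℝ) * (3 / 16 * n) ≤ 1 / n * M.outputExp L (missCount σ) := by gcongr
    have h3 : 1 / (n : ℝ) * (3 / 16 * n) = 3 / 16 := by field_simp
    linarith
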